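/- Let $b>0$ be real. For every real $x\ge 0$ the product $\prod_{k=0}^\infty\left(1+\frac{x^3}{(k+b)^3}\right)$ converges unconditionally, both integrals below converge absolutely, and $$\int_0^\infty\frac{dx}{\prod_{k=0}^\infty\left(1+\frac{x^3}{(k+b)^3}\right)}=\frac{4\pi\,\Gamma(3b)}{\Gamma(b)^3\sqrt3}\int_{-\infty}^\infty\frac{e^{ixb\sqrt3}\,dx}{\left(e^x+e^{-x}+e^{ix\sqrt3}\right)^{3b}},$$ where the complex power is the principal branch (the base has positive real part for every real $x$). Moreover, in the case $b=1$, $$\int_0^\infty\frac{dx}{\prod_{k=1}^\infty\left(1+\frac{x^3}{k^3}\right)}=8\pi\int_0^\infty\frac{e^{x\sqrt3}\,dx}{\left(2\cos x+e^{x\sqrt3}\right)^3},$$ where the integral on the right-hand side also converges absolutely. -/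

import Mathlib

open MeasureTheory

/-!
Write `a k = k + b` and let `ω` be a primitive cube root of unity. The product is the limit of the
finite products `∏ k < M, (1 + x ^ 3 / a k ^ 3)`, and the reciprocal of each of them has the
elementary partial fraction expansion
`∑ k < M, c M k / (1 + x ^ 3 / a k ^ 3)` with `c M k = ∏ j ≠ k, (1 - a k ^ 3 / a j ^ 3)⁻¹`
(`inv_prod_one_sub_div_eq_sum`). Since `∫₀^∞ dx / (1 + x ^ 3 / a ^ 3) = 2π a / (3√3)`, the integral
of the finite product is `(2π / √3) ∑ k < M, c M k * a k / 3`.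

Factoring `1 - z ^ 3` over the cube roots of unity and comparing with Euler's product for `Γ` shows
that `c M k * a k / 3` tends to `(-1) ^ k / k! * Γ(b - ω a k) Γ(b - ω̄ a k) / Γ(b) ^ 3`, which is, up
to normalization, the residue of `Γ(b - z) Γ(b - ω z) Γ(b - ω̄ z)` at `z = a k`
(`tendsto_cubicCoeff`). The factors that enter `c M k` when `M` grows all exceed `1`, so `|c M k|`
increases with `M` and is bounded by its limit (`norm_cubicCoeff_le`). Hence Tannery's theorem gives
the limit of the sums once the limiting series converges absolutely. This replaces any estimate of
`Γ` on large contours.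

The two arguments of the Gamma functions have sum `3b + k` and difference `± i √3 (k + b)`, so the
Beta integral, written over the real line by means of the logistic substitution, turns the limiting
series into an integral of
`∑ k, (-1) ^ k * Γ(3b + k) / k! * exp (i √3 (k + b) x) * (2 cosh x) ^ (-(3b + k))`.
This is a binomial series in `exp (i √3 x) / (2 cosh x)`, of modulus at most `1 / 2`, with sum
`Γ(3b) * exp (i √3 b x) * (2 cosh x + exp (i √3 x)) ^ (-3b)` (`hasSum_cubicKernelTerm`).

For `b = 1` the integrand is `exp (i √3 z) / (exp z + exp (-z) + exp (i √3 z)) ^ 3`. It is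
holomorphic and decays exponentially in the sector `0 ≤ arg z ≤ π / 6`, and equals
`exp (√3 r) / (2 cos r + exp (√3 r)) ^ 3` at `z = r exp (iπ / 6)`. Rotating the contour to this ray
(`integral_Ioi_eq_integral_ray`) and adding the complex conjugate, which comes from the negative
half-line, produces the factor `2 cos (π / 6) = √3`.
-/

open Filter Topology

/-! ### Partial fractions -/

/-- Partial fractions with simple poles. Clearing denominators, this says that the Lagrange basis
polynomials at the nodes `A i` sum to one. -/
theorem inv_prod_one_sub_div_eq_sum {ι K : Type*} [DecidableEq ι] [Field K] {A : ι → K}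
    (hA : Function.Injective A) (hA0 : ∀ i, A i ≠ 0) {s : Finset ι} (hs : s.Nonempty) {w : K}
    (hw : ∀ i, w ≠ A i) :
    (∏ i ∈ s, (1 - w / A i))⁻¹ =
      ∑ i ∈ s, (∏ j ∈ s.erase i, (1 - A i / A j))⁻¹ * (1 - w / A i)⁻¹ := by
  have key : ∑ i ∈ s, ∏ j ∈ s.erase i, ((1 - w / A j) / (1 - A i / A j)) = 1 := by
    have h := congrArg (Polynomial.eval w) (Lagrange.sum_basis (v := A) hA.injOn hs)
    rw [Polynomial.eval_finsetSum, Polynomial.eval_one] at h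
    refine Eq.trans ?_ h
    refine Finset.sum_congr rfl fun i hi => ?_
    rw [Lagrange.basis, Polynomial.eval_prod]
    refine Finset.prod_congr rfl fun j hj => ?_
    have hij : A i - A j ≠ 0 := sub_ne_zero.2 (hA.ne (Finset.ne_of_mem_erase hj).symm)
    have hji : A j - A i ≠ 0 := sub_ne_zero.2 (hA.ne (Finset.ne_of_mem_erase hj))
    have h1 : 1 - A i / A j ≠ 0 := by
      have : 1 - A i / A j = (A j - A i) / A j := by field_simp [hA0 j]
      rw [this]; exact div_ne_zero hji (hA0 j)
    simp only [Lagrange.basisDivisor, Polynomial.eval_mul, Polynomial.eval_C, Polynomial.eval_sub,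
      Polynomial.eval_X]
    rw [div_eq_iff h1]
    field_simp [hA0 j]
    ring
  have hne : ∀ i, 1 - w / A i ≠ 0 := fun i => by
    have : 1 - w / A i = (A i - w) / A i := by field_simp [hA0 i]
    rw [this]; exact div_ne_zero (sub_ne_zero.2 (hw i).symm) (hA0 i)
  have hprod : ∏ i ∈ s, (1 - w / A i) ≠ 0 := Finset.prod_ne_zero_iff.2 fun i _ => hne i
  rw [← mul_right_inj' hprod, mul_inv_cancel₀ hprod,
    Finset.mul_sum]
  refine Eq.trans key.symm ?_
  refine Finset.sum_congr rfl fun i hi => ?_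
  rw [Finset.prod_div_distrib, ← Finset.mul_prod_erase s _ hi]
  field_simp [hne i]

/-! ### The integral of `1 / (1 + x ^ 3 / a ^ 3)` -/

theorem integrableOn_inv_one_add_cube_div {a : ℝ} (ha : 0 < a) :
    IntegrableOn (fun x : ℝ => (1 + x ^ 3 / a ^ 3)⁻¹) (Set.Ioi 0) := by
  have hint : Integrable (fun x : ℝ => 2 * (1 + (x / a) ^ 2)⁻¹) :=
    (integrable_inv_one_add_sq.comp_div ha.ne').const_mul 2
  refine hint.integrableOn.mono' (by fun_prop) ?_
  filter_upwards [ae_restrict_mem measurableSet_Ioi] with x hx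
  have hu : 0 < x / a := div_pos hx ha
  rw [← div_pow]
  generalize x / a = u at hu
  rw [Real.norm_of_nonneg (by positivity), ← div_eq_mul_inv, inv_eq_one_div,
    div_le_div_iff₀ (by positivity) (by positivity)]
  nlinarith [mul_nonneg hu.le (sq_nonneg (u - 1)), sq_nonneg (u - 1), pow_pos hu 3,
    mul_nonneg (by positivity : (0:ℝ) ≤ u + 1) (sq_nonneg (u - 1)) ]

theorem integral_inv_one_add_cube :
    ∫ x in Set.Ioi (0 : ℝ), (1 + x ^ 3)⁻¹ = 2 * Real.pi / (3 * √3) := by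
  have h3 : (√3 : ℝ) ^ 2 = 3 := Real.sq_sqrt (by norm_num)
  have h3' : (0 : ℝ) < √3 := by positivity
  set f : ℝ → ℝ := fun x => 1 / 3 * Real.log (1 + x) - 1 / 6 * Real.log (x ^ 2 - x + 1) +
    1 / √3 * Real.arctan ((2 * x - 1) / √3) with hf
  have hq : ∀ x : ℝ, 0 < x ^ 2 - x + 1 := fun x => by nlinarith [sq_nonneg (x - 1 / 2)]
  -- `f` is the classical antiderivative coming from `1 + x ^ 3 = (1 + x) * (x ^ 2 - x + 1)`
  have hderiv : ∀ x ∈ Set.Ici (0 : ℝ), HasDerivAt f ((1 + x ^ 3)⁻¹) x := by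
    intro x hx
    have hx1 : 0 < 1 + x := by have : (0 : ℝ) ≤ x := hx; linarith
    have hqx := hq x
    have d1 := (((hasDerivAt_id x).const_add 1).log hx1.ne').const_mul (1 / 3)
    have d2 := (((((hasDerivAt_id x).pow 2).sub (hasDerivAt_id x)).add_const 1).log
      hqx.ne').const_mul (1 / 6)
    have d3 := (((((hasDerivAt_id x).const_mul 2).sub_const 1).div_const √3).arctan).const_mul
      (1 / √3)
    refine ((d1.sub d2).add d3).congr_deriv ?_
    have e : 1 + ((2 * x - 1) / √3) ^ 2 = 4 / 3 * (x ^ 2 - x + 1) := by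
      rw [div_pow, h3]; ring
    have e2 : 1 + x ^ 3 = (1 + x) * (x ^ 2 - x + 1) := by ring
    simp only [id, e, e2, Pi.sub_apply, Pi.pow_apply]
    have : (1 : ℝ) / √3 * (1 / (4 / 3 * (x ^ 2 - x + 1)) * (2 * 1 / √3)) =
        1 / 2 / (x ^ 2 - x + 1) := by
      field_simp
      rw [h3]; norm_num
    rw [this]
    obtain ⟨Q, hQ⟩ : ∃ Q, Q = x ^ 2 - x + 1 := ⟨_, rfl⟩
    rw [← hQ] at hqx ⊢
    field_simp
    rw [hQ]
    ring
  have hlim : Tendsto f atTop (𝓝 (0 + 1 / √3 * (Real.pi / 2))) := by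
    -- the two logarithms combine to one whose argument tends to `1`
    have l1 : Tendsto (fun x : ℝ => 1 / 6 * Real.log ((1 + x) ^ 2 / (x ^ 2 - x + 1))) atTop
        (𝓝 0) := by
      have : Tendsto (fun x : ℝ => (1 + x) ^ 2 / (x ^ 2 - x + 1)) atTop (𝓝 1) := by
        have hinv : Tendsto (fun x : ℝ => x⁻¹) atTop (𝓝 0) := tendsto_inv_atTop_zero
        have := (((hinv.add_const 1).pow 2).div
          (((hinv.pow 2).sub hinv).add_const 1) (by norm_num))
        norm_num at this
        refine this.congr' ?_
        filter_upwards [eventually_gt_atTop 0] with x hx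
        have h2 := (hq x).ne'
        have h3 : (x⁻¹ ^ 2 - x⁻¹ + 1) = (x ^ 2 - x + 1) / x ^ 2 := by field_simp; ring
        simp only [Pi.div_apply]
        rw [inv_pow] at h3
        rw [h3]
        field_simp
      have := ((Real.continuousAt_log one_ne_zero).tendsto.comp this).const_mul (1 / 6)
      simpa using this
    have l2 : Tendsto (fun x : ℝ => 1 / √3 * Real.arctan ((2 * x - 1) / √3)) atTop
        (𝓝 (1 / √3 * (Real.pi / 2))) := by
      refine ((Real.tendsto_arctan_atTop.mono_right nhdsWithin_le_nhds).comp ?_).const_mul _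
      refine Tendsto.atTop_div_const h3' ?_
      exact tendsto_atTop_add_const_right _ _ (tendsto_id.const_mul_atTop two_pos)
    refine (l1.add l2).congr' ?_
    filter_upwards [eventually_gt_atTop 0] with x hx
    have : 0 < 1 + x := by linarith
    rw [hf, Real.log_div (by positivity) (hq x).ne', Real.log_pow]
    push_cast
    ring
  have hint : IntegrableOn (fun x : ℝ => (1 + x ^ 3)⁻¹) (Set.Ioi 0) := by
    simpa using integrableOn_inv_one_add_cube_div one_pos
  rw [integral_Ioi_of_hasDerivAt_of_tendsto' hderiv hint hlim, hf]
  have : Real.arctan (-1 / √3) = -(Real.pi / 6) := by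
    rw [neg_div, Real.arctan_neg, ← Real.tan_pi_div_six, Real.arctan_tan] <;>
      linarith [Real.pi_pos]
  simp only [mul_zero, zero_sub, this]
  field_simp
  norm_num
  ring

theorem integral_inv_one_add_cube_div {a : ℝ} (ha : 0 < a) :
    ∫ x in Set.Ioi (0 : ℝ), (1 + x ^ 3 / a ^ 3)⁻¹ = a * (2 * Real.pi / (3 * √3)) := by
  have h := integral_comp_mul_left_Ioi (fun x : ℝ => (1 + x ^ 3)⁻¹) 0 (inv_pos.2 ha)
  rw [mul_zero, integral_inv_one_add_cube, inv_inv, smul_eq_mul] at h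
  rw [← h]
  refine integral_congr_ae (ae_of_all _ fun x => ?_)
  simp only [mul_pow, inv_pow, div_eq_mul_inv, mul_comm]

/-! ### Binomial coefficients and the Gamma function -/

theorem Complex.choose_mul_Gamma (s : ℂ) (hs : ∀ m : ℕ, s ≠ -m) (k : ℕ) :
    Ring.choose (s + k - 1) k * Complex.Gamma s = Complex.Gamma (s + k) / k.factorial := by
  have h1 : ∀ k : ℕ, (ascPochhammer ℂ k).eval s * Complex.Gamma s = Complex.Gamma (s + k) := by
    intro k
    induction k with
    | zero => simp
    | succ k ih =>
      have : s + k ≠ 0 := fun h => hs k (eq_neg_of_add_eq_zero_left h)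
      rw [ascPochhammer_succ_right, Polynomial.eval_mul, mul_right_comm, ih]
      push_cast
      rw [← add_assoc, Complex.Gamma_add_one _ this]
      simp [mul_comm]
  have h2 := Ring.factorial_nsmul_multichoose_eq_ascPochhammer s k
  rw [← Ring.multichoose_eq, eq_div_iff (by exact_mod_cast k.factorial_ne_zero), ← h1,
    ← Polynomial.ascPochhammer_smeval_eq_eval, 
    ← h2, nsmul_eq_mul]
  ring

/-! ### The coefficients of the partial fraction expansion -/

theorem prod_erase_natCast_sub (k m : ℕ) :
    ∏ j ∈ (Finset.range (k + m + 1)).erase k, ((j : ℂ) - k) =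
      (-1) ^ k * k.factorial * m.factorial := by
  induction m with
  | zero =>
    have h : ∀ j ∈ Finset.range k, ((k - 1 - j : ℕ) : ℂ) - k = (-1) * ((j + 1 : ℕ) : ℂ) := by
      intro j hj
      have hj := Finset.mem_range.1 hj
      rw [Nat.sub_sub, Nat.cast_sub (by omega)]
      push_cast
      ring
    rw [add_zero, Finset.range_add_one, Finset.erase_insert Finset.notMem_range_self,
      ← Finset.prod_range_reflect, Finset.prod_congr rfl h, Finset.prod_mul_distrib,
      Finset.prod_const, Finset.card_range, ← Nat.cast_prod,
      Finset.prod_range_add_one_eq_factorial]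
    simp
  | succ m ih =>
    rw [← add_assoc, Finset.range_add_one, Finset.erase_insert_of_ne (by omega),
      Finset.prod_insert (by simp), ih, Nat.factorial_succ]
    push_cast
    ring

/-- The coefficient of `(1 + x ^ 3 / (k + b) ^ 3)⁻¹` in the partial fraction expansion of
`(∏ j < M, (1 + x ^ 3 / (j + b) ^ 3))⁻¹`. -/
noncomputable def cubicCoeff (b : ℝ) (M k : ℕ) : ℝ :=
  (∏ j ∈ (Finset.range M).erase k, (1 - ((k : ℝ) + b) ^ 3 / ((j : ℝ) + b) ^ 3))⁻¹

/-- The number `b - ω (k + b)`, where `ω` is the primitive cube root of unity in the lower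
half-plane. Its complex conjugate belongs to the other primitive cube root. -/
noncomputable def cubicNode (b : ℝ) (k : ℕ) : ℂ :=
  b + (1 + √3 * Complex.I) / 2 * (k + b)

theorem sqrt_three_mul_I_sq : ((√3 : ℝ) * Complex.I : ℂ) ^ 2 = -3 := by
  rw [mul_pow, Complex.I_sq, ← Complex.ofReal_pow, Real.sq_sqrt (by norm_num)]
  norm_num

theorem conj_cubicNode (b : ℝ) (k : ℕ) :
    starRingEnd ℂ (cubicNode b k) = b + (1 - √3 * Complex.I) / 2 * (k + b) := by
  have h2 : starRingEnd ℂ 2 = 2 := Complex.conj_ofNat 2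
  simp [cubicNode, sub_eq_add_neg, h2]

theorem cubicNode_re (b : ℝ) (k : ℕ) : (cubicNode b k).re = (3 * b + k) / 2 := by
  simp [cubicNode]
  ring

theorem cubicNode_add_conj (b : ℝ) (k : ℕ) :
    cubicNode b k + starRingEnd ℂ (cubicNode b k) = 3 * b + k := by
  rw [conj_cubicNode, cubicNode]
  ring

theorem cubicNode_sub_conj (b : ℝ) (k : ℕ) :
    cubicNode b k - starRingEnd ℂ (cubicNode b k) = √3 * Complex.I * (k + b) := by
  rw [conj_cubicNode, cubicNode]
  ring

/-- The right-hand side is the quadratic factor of `(b + j) ^ 3 - (k + b) ^ 3`. -/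
theorem cubicNode_add_mul_conj_add (b : ℝ) (k : ℕ) (j : ℂ) :
    (cubicNode b k + j) * (starRingEnd ℂ (cubicNode b k) + j) =
      (b + j) ^ 2 + (b + j) * (k + b) + (k + b) ^ 2 := by
  rw [conj_cubicNode, cubicNode]
  linear_combination -((k + b : ℂ) ^ 2 / 4) * sqrt_three_mul_I_sq

/-- Splitting `1 - z ^ 3` into linear factors turns the coefficients of the finite partial fraction
expansion into quotients of Euler's approximations to the Gamma function. -/
theorem cubicCoeff_eq_GammaSeq {b : ℝ} (hb : 0 < b) {k n : ℕ} (hkn : k ≤ n) (hn : n ≠ 0) :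
    (cubicCoeff b (n + 1) k : ℂ) * (k + b) / 3 =
      (-1) ^ k / k.factorial * (n.descFactorial k / (n : ℂ) ^ k) *
        (Complex.GammaSeq (cubicNode b k) n *
          Complex.GammaSeq (starRingEnd ℂ (cubicNode b k)) n / Complex.GammaSeq b n ^ 3) := by
  set u := cubicNode b k with hu
  set v := starRingEnd ℂ u with hv
  set s := (Finset.range (n + 1)).erase k with hs
  have hks : k ∈ Finset.range (n + 1) := Finset.mem_range.2 (by omega)
  have hbj : ∀ j : ℕ, (b : ℂ) + j ≠ 0 := fun j => by
    exact_mod_cast (by positivity : b + (j : ℝ) ≠ 0)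
  have hure : 0 < u.re := by rw [hu, cubicNode_re]; positivity
  have hvre : 0 < v.re := by rw [hv, Complex.conj_re]; exact hure
  have hne : ∀ w : ℂ, 0 < w.re → ∀ j : ℕ, w + j ≠ 0 := fun w hw j h => by
    have := congrArg Complex.re h
    simp only [Complex.add_re, Complex.natCast_re, Complex.zero_re] at this
    have : (0 : ℝ) ≤ j := j.cast_nonneg
    linarith
  have huj := hne u hure
  have hvj := hne v hvre
  obtain ⟨m, rfl⟩ := Nat.exists_eq_add_of_le hkn
  have hterm : ∀ j : ℕ, (1 - ((k : ℂ) + b) ^ 3 / ((j : ℂ) + b) ^ 3) =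
      ((j : ℂ) - k) * ((u + j) * (v + j)) / (b + j) ^ 3 := by
    intro j
    have h0 := hbj j
    rw [hv, hu, cubicNode_add_mul_conj_add, add_comm (j : ℂ) b]
    field_simp
    ring
  have hcoeff : (cubicCoeff b (k + m + 1) k : ℂ)⁻¹ =
      (-1) ^ k * k.factorial * m.factorial *
        ((∏ j ∈ s, (u + j)) * ∏ j ∈ s, (v + j)) / (∏ j ∈ s, ((b : ℂ) + j)) ^ 3 := by
    rw [cubicCoeff]
    push_cast
    rw [inv_inv, Finset.prod_congr rfl fun j _ => hterm j, Finset.prod_div_distrib,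
      Finset.prod_mul_distrib, Finset.prod_mul_distrib, Finset.prod_pow, ← hs,
      hs, prod_erase_natCast_sub]
  have hPu := Finset.mul_prod_erase _ (fun j : ℕ => u + j) hks
  have hPv := Finset.mul_prod_erase _ (fun j : ℕ => v + j) hks
  have hPb := Finset.mul_prod_erase _ (fun j : ℕ => (b : ℂ) + j) hks
  have huv : (u + k) * (v + k) = 3 * (b + k) ^ 2 := by
    rw [hv, hu, cubicNode_add_mul_conj_add]
    ring
  have hPu0 : ∏ j ∈ s, (u + j) ≠ 0 := Finset.prod_ne_zero_iff.2 fun j _ => huj j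
  have hPv0 : ∏ j ∈ s, (v + j) ≠ 0 := Finset.prod_ne_zero_iff.2 fun j _ => hvj j
  have hPb0 : ∏ j ∈ s, ((b : ℂ) + j) ≠ 0 := Finset.prod_ne_zero_iff.2 fun j _ => hbj j
  have hn0 : ((k + m : ℕ) : ℂ) ≠ 0 := by exact_mod_cast hn
  -- the powers of `n` cancel except for `n ^ k`, because the two nodes add up to `3 * b + k`
  have hpow : ((k + m : ℕ) : ℂ) ^ u * ((k + m : ℕ) : ℂ) ^ v =
      (((k + m : ℕ) : ℂ) ^ (b : ℂ)) ^ 3 * ((k + m : ℕ) : ℂ) ^ k := by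
    rw [← Complex.cpow_add _ _ hn0, hv, hu, cubicNode_add_conj, Complex.cpow_add _ _ hn0,
      Complex.cpow_natCast, ← Complex.cpow_nat_mul]
    norm_num
  have hdf : ((k + m).factorial : ℂ) = m.factorial * (k + m).descFactorial k := by
    have := Nat.factorial_mul_descFactorial (Nat.le_add_right k m)
    rw [Nat.add_sub_cancel_left] at this
    exact_mod_cast this.symm
  have hb0 : ((k + m : ℕ) : ℂ) ^ (b : ℂ) ≠ 0 := fun h =>
    hn0 ((Complex.cpow_eq_zero_iff _ _).1 h).1
  have hfac : ((k + m).factorial : ℂ) ≠ 0 := by exact_mod_cast (k + m).factorial_ne_zero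
  have hk0 : (k.factorial : ℂ) ≠ 0 := by exact_mod_cast k.factorial_ne_zero
  have hm0 : (m.factorial : ℂ) ≠ 0 := by exact_mod_cast m.factorial_ne_zero
  have hd0 : ((k + m).descFactorial k : ℂ) ≠ 0 := by
    intro h; rw [h, mul_zero] at hdf; exact hfac hdf
  simp only [Complex.GammaSeq]
  rw [← hPu, ← hPv, ← hPb, ← inv_inv (cubicCoeff b (k + m + 1) k : ℂ), hcoeff,
    add_comm (k : ℂ) b]
  simp only [← hs]
  generalize ∏ j ∈ s, (u + j) = Pu at *
  generalize ∏ j ∈ s, (v + j) = Pv at *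
  generalize ∏ j ∈ s, ((b : ℂ) + j) = Pb at *
  have hsign : ((-1 : ℂ) ^ k) * (-1) ^ k = 1 := by rw [← mul_pow]; norm_num
  have e1 : ((k + m : ℕ) : ℂ) ^ u * (k + m).factorial / ((u + k) * Pu) *
      (((k + m : ℕ) : ℂ) ^ v * (k + m).factorial / ((v + k) * Pv)) =
      (((k + m : ℕ) : ℂ) ^ (b : ℂ)) ^ 3 * ((k + m : ℕ) : ℂ) ^ k * (k + m).factorial ^ 2 /
        (3 * (b + k) ^ 2 * (Pu * Pv)) := by
    rw [div_mul_div_comm, ← hpow, ← huv]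
    ring_nf
  rw [e1, hdf]
  have hbk := hbj k
  have hsg : ((-1 : ℂ) ^ k) ≠ 0 := by simp
  generalize ((-1 : ℂ) ^ k) = sg at *
  field_simp
  linear_combination (-1 : ℂ) * hsign

theorem tendsto_descFactorial_div_pow (k : ℕ) :
    Tendsto (fun n : ℕ => (n.descFactorial k : ℂ) / (n : ℂ) ^ k) atTop (𝓝 1) := by
  have h := (Asymptotics.isEquivalent_iff_tendsto_one ?_).1 (isEquivalent_descFactorial k)
  · have h' := (Complex.continuous_ofReal.tendsto 1).comp h
    simpa [Function.comp_def] using h'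
  · filter_upwards [eventually_gt_atTop 0] with n hn
    positivity

theorem tendsto_cubicCoeff {b : ℝ} (hb : 0 < b) (k : ℕ) :
    Tendsto (fun M => (cubicCoeff b M k : ℂ) * (k + b) / 3) atTop
      (𝓝 ((-1) ^ k / k.factorial * (Complex.Gamma (cubicNode b k) *
          Complex.Gamma (starRingEnd ℂ (cubicNode b k)) / Complex.Gamma b ^ 3))) := by
  rw [← tendsto_add_atTop_iff_nat 1]
  have hG : Complex.Gamma b ≠ 0 := Complex.Gamma_ne_zero_of_re_pos (by simpa using hb)
  have h := ((tendsto_descFactorial_div_pow k).const_mul ((-1) ^ k / (k.factorial : ℂ))).mul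
    (((Complex.GammaSeq_tendsto_Gamma (cubicNode b k)).mul
      (Complex.GammaSeq_tendsto_Gamma (starRingEnd ℂ (cubicNode b k)))).div
      ((Complex.GammaSeq_tendsto_Gamma b).pow 3) (pow_ne_zero _ hG))
  rw [mul_one] at h
  refine h.congr' ?_
  filter_upwards [eventually_ge_atTop k, eventually_ge_atTop 1] with n hk hn
  exact (cubicCoeff_eq_GammaSeq hb hk (by omega)).symm

/-- Enlarging `M` multiplies the coefficient by factors of modulus at least one, so every
coefficient is dominated by its limit. -/
theorem abs_cubicCoeff_monotone {b : ℝ} (hb : 0 < b) (k : ℕ) :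
    Monotone fun m => |cubicCoeff b (k + 1 + m) k| := by
  refine monotone_nat_of_le_succ fun m => ?_
  have hlt : k < k + 1 + m := by omega
  have h1 : ((k : ℝ) + b) ^ 3 < (((k + 1 + m : ℕ) : ℝ) + b) ^ 3 := by
    gcongr
  have h0 : 0 < ((k : ℝ) + b) ^ 3 := by positivity
  have h2 : ((k : ℝ) + b) ^ 3 / (((k + 1 + m : ℕ) : ℝ) + b) ^ 3 < 1 :=
    (div_lt_one (by positivity)).2 h1
  have h3 : 0 < ((k : ℝ) + b) ^ 3 / (((k + 1 + m : ℕ) : ℝ) + b) ^ 3 := by positivity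
  have h4 : (1 : ℝ) ≤ (1 - ((k : ℝ) + b) ^ 3 / (((k + 1 + m : ℕ) : ℝ) + b) ^ 3)⁻¹ :=
    (one_le_inv₀ (by linarith)).2 (by linarith)
  rw [← add_assoc, cubicCoeff, cubicCoeff, Finset.range_add_one,
    Finset.erase_insert_of_ne hlt.ne', Finset.prod_insert (by simp), mul_inv, abs_mul,
    abs_of_pos (zero_lt_one.trans_le h4)]
  exact le_mul_of_one_le_left (abs_nonneg _) h4

theorem norm_cubicCoeff_le {b : ℝ} (hb : 0 < b) {k M : ℕ} (hk : k < M) :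
    ‖(cubicCoeff b M k : ℂ) * (k + b) / 3‖ ≤
      ‖(-1) ^ k / k.factorial * (Complex.Gamma (cubicNode b k) *
          Complex.Gamma (starRingEnd ℂ (cubicNode b k)) / Complex.Gamma b ^ 3)‖ := by
  obtain ⟨m, rfl⟩ := Nat.exists_eq_add_of_le (Nat.succ_le_of_lt hk)
  have hlim := ((tendsto_cubicCoeff hb k).norm.comp (tendsto_add_atTop_nat (k + 1)))
  have hmono : Monotone fun m => ‖(cubicCoeff b (k + 1 + m) k : ℂ) * (k + b) / 3‖ := by
    intro m n hmn
    have := abs_cubicCoeff_monotone hb k hmn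
    simp only [norm_mul, norm_div, Complex.norm_real, Real.norm_eq_abs]
    gcongr
  refine hmono.ge_of_tendsto (hlim.congr fun n => ?_) m
  simp only [Function.comp, add_comm n]

/-! ### The Beta integral over the real line -/

theorem integrable_exp_neg_mul_abs {c : ℝ} (hc : 0 < c) :
    Integrable (fun x : ℝ => Real.exp (-(c * |x|))) := by
  rw [← integrableOn_univ, ← Set.Iic_union_Ioi (a := (0 : ℝ)), integrableOn_union]
  constructor
  · refine (integrableOn_exp_mul_Iic hc 0).congr_fun (fun x hx => ?_) measurableSet_Iic
    simp [abs_of_nonpos (Set.mem_Iic.1 hx)]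
  · refine (integrableOn_exp_mul_Ioi (neg_neg_of_pos hc) 0).congr_fun (fun x hx => ?_)
      measurableSet_Ioi
    simp [abs_of_pos (Set.mem_Ioi.1 hx)]

theorem integrable_two_cosh_rpow_neg {c : ℝ} (hc : 0 < c) :
    Integrable (fun x : ℝ => (2 * Real.cosh x) ^ (-c)) := by
  refine (integrable_exp_neg_mul_abs hc).mono' ?_ (ae_of_all _ fun x => ?_)
  · refine Continuous.aestronglyMeasurable (Continuous.rpow_const (by fun_prop) fun x => ?_)
    left; positivity
  · have hx : Real.exp |x| ≤ 2 * Real.cosh x := by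
      rw [← Real.cosh_abs, Real.cosh_eq]
      linarith [Real.exp_pos (-|x|)]
    rw [Real.norm_of_nonneg (by positivity)]
    calc (2 * Real.cosh x) ^ (-c) ≤ (Real.exp |x|) ^ (-c) :=
          Real.rpow_le_rpow_of_nonpos (Real.exp_pos _) hx (by linarith)
      _ = Real.exp (-(c * |x|)) := by rw [← Real.exp_mul]; ring_nf

/-- The substitution `t = e ^ x / (e ^ x + e ^ (-x))` in Euler's Beta integral. -/
theorem betaIntegral_eq_integral_two_cosh (u v : ℂ) :
    Complex.betaIntegral u v =
      2 * ∫ x : ℝ, Complex.exp ((u - v) * x) * ((2 * Real.cosh x : ℝ) : ℂ) ^ (-(u + v)) := by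
  have hσ := integral_image_eq_integral_abs_deriv_smul (f := Real.sigmoid) (s := Set.univ)
    MeasurableSet.univ (fun x _ => (Real.hasDerivAt_sigmoid x).hasDerivWithinAt)
    Real.sigmoid_injective.injOn
    (fun t : ℝ => (t : ℂ) ^ (u - 1) * (1 - (t : ℂ)) ^ (v - 1))
  rw [Set.image_univ, Real.range_sigmoid, setIntegral_univ] at hσ
  rw [Complex.betaIntegral, intervalIntegral.integral_of_le zero_le_one,
    integral_Ioc_eq_integral_Ioo, hσ]
  -- the logistic function at `2 * x` is `e ^ x / (e ^ x + e ^ (-x))`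
  have hscale := Measure.integral_comp_mul_left
    (fun x : ℝ => |Real.sigmoid x * (1 - Real.sigmoid x)| •
      ((Real.sigmoid x : ℂ) ^ (u - 1) * (1 - (Real.sigmoid x : ℂ)) ^ (v - 1))) 2
  rw [abs_of_pos (by norm_num : (0:ℝ) < 2⁻¹), Complex.real_smul] at hscale
  have h2 : ∀ z : ℂ, z = 2 * (((2⁻¹ : ℝ) : ℂ) * z) := fun z => by push_cast; ring
  rw [h2 (∫ x, _), ← hscale]
  congr 1
  refine integral_congr_ae (ae_of_all _ fun x => ?_)
  set C := 2 * Real.cosh x with hC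
  have hC0 : 0 < C := by positivity
  have hs : ∀ y : ℝ, Real.cosh y = Real.cosh x →
      Real.sigmoid (2 * y) = Real.exp (y - Real.log C) := by
    intro y hy
    rw [Real.exp_sub, Real.exp_log hC0, hC, ← hy, Real.cosh_eq, Real.sigmoid_def,
      show -(2 * y) = -y + -y by ring, Real.exp_add, Real.exp_neg]
    have := Real.exp_pos y
    field_simp
  have h1 := hs x rfl
  have h1' : 1 - Real.sigmoid (2 * x) = Real.exp (-x - Real.log C) := by
    rw [← Real.sigmoid_neg, ← mul_neg, hs (-x) (Real.cosh_neg x)]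
  have hcp : ∀ (y : ℝ) (w : ℂ), ((Real.exp y : ℝ) : ℂ) ^ w = Complex.exp (y * w) := by
    intro y w
    rw [Complex.cpow_def_of_ne_zero (by exact_mod_cast (Real.exp_pos y).ne'),
      ← Complex.ofReal_log (Real.exp_pos y).le, Real.log_exp]
  have hcC : (C : ℂ) = ((Real.exp (Real.log C) : ℝ) : ℂ) := by rw [Real.exp_log hC0]
  dsimp only
  rw [show (1 : ℂ) - (Real.sigmoid (2 * x) : ℂ) = ((1 - Real.sigmoid (2 * x) : ℝ) : ℂ) by
    push_cast; ring, h1', h1, ← Real.exp_add, abs_of_pos (Real.exp_pos _), Complex.real_smul,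
    hcC, hcp, hcp, hcp, Complex.ofReal_exp, ← Complex.exp_add, ← Complex.exp_add,
    ← Complex.exp_add]
  congr 1
  push_cast
  ring

/-! ### The binomial expansion of the kernel -/

/-- The binomial series. Its coefficients are `Γ(s + k) / (k! * Γ(s))` by
`Complex.choose_mul_Gamma`. -/
theorem Complex.hasSum_choose_mul_neg_pow (s : ℂ) {z : ℂ} (hz : ‖z‖ < 1) :
    HasSum (fun k : ℕ => Ring.choose (s + k - 1) k * (-z) ^ k) ((1 + z) ^ (-s)) := by
  have h := (Complex.one_div_one_sub_cpow_hasFPowerSeriesOnBall_zero s).hasSum (y := -z)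
    (by simpa [Metric.mem_eball, edist_zero_right, enorm_eq_nnnorm, ← NNReal.coe_lt_coe] using hz)
  simpa [Complex.cpow_neg, mul_comm] using h

theorem Real.summable_choose_mul_pow {s : ℝ} {r : ℝ} (hr0 : 0 ≤ r) (hr : r < 1) :
    Summable (fun k : ℕ => Ring.choose (s + k - 1) k * r ^ k) := by
  have h := (Complex.hasSum_choose_mul_neg_pow s (z := -r)
    (by simpa [abs_of_nonneg hr0] using hr)).summable
  rw [← Complex.summable_ofReal]
  refine h.congr fun k => ?_
  push_cast [Complex.ofReal_choose]
  simp

/-- The complex integrand attached to the parameter `b`. -/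
noncomputable def cubicKernel (b x : ℝ) : ℂ :=
  Complex.exp (Complex.I * x * b * (√3 : ℝ)) /
    (Complex.exp x + Complex.exp (-x) + Complex.exp (Complex.I * x * (√3 : ℝ))) ^ (3 * b : ℂ)

/-- The `k`-th term of the binomial expansion of `cubicKernel b x` in powers of
`exp (i x √3) / (2 cosh x)`. -/
noncomputable def cubicKernelTerm (b : ℝ) (k : ℕ) (x : ℝ) : ℂ :=
  (-1) ^ k * Ring.choose (3 * b + k - 1 : ℂ) k *
    (Complex.exp (√3 * Complex.I * (k + b) * x) *
      ((2 * Real.cosh x : ℝ) : ℂ) ^ (-(3 * b + k : ℂ)))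

theorem norm_exp_I_mul_mul (x c : ℝ) : ‖Complex.exp (Complex.I * x * c)‖ = 1 := by
  rw [show Complex.I * x * c = ((x * c : ℝ) : ℂ) * Complex.I by push_cast; ring,
    Complex.norm_exp_ofReal_mul_I]

theorem two_le_two_cosh (x : ℝ) : 2 ≤ 2 * Real.cosh x := by
  linarith [Real.one_le_cosh x]

theorem norm_exp_div_two_cosh_le (x : ℝ) :
    ‖Complex.exp (Complex.I * x * (√3 : ℝ)) / (2 * Real.cosh x : ℝ)‖ ≤ 1 / 2 := by
  rw [norm_div, norm_exp_I_mul_mul, Complex.norm_real,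
    Real.norm_of_nonneg (by positivity)]
  exact one_div_le_one_div_of_le two_pos (two_le_two_cosh x)

theorem cubicKernel_eq (b x : ℝ) :
    cubicKernel b x = Complex.exp (Complex.I * x * b * (√3 : ℝ)) *
      (((2 * Real.cosh x : ℝ) : ℂ) ^ (-(3 * b : ℂ)) *
        (1 + Complex.exp (Complex.I * x * (√3 : ℝ)) / (2 * Real.cosh x : ℝ)) ^ (-(3 * b : ℂ))) := by
  have hC : 0 < 2 * Real.cosh x := by positivity
  have hX := norm_exp_div_two_cosh_le x
  set X := Complex.exp (Complex.I * x * (√3 : ℝ)) / (2 * Real.cosh x : ℝ) with hXdef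
  have hC0 : ((2 * Real.cosh x : ℝ) : ℂ) ≠ 0 := by exact_mod_cast hC.ne'
  have h1X : 1 + X ≠ 0 := by
    intro h
    rw [eq_neg_of_add_eq_zero_right h] at hX
    norm_num at hX
  have hbase : Complex.exp x + Complex.exp (-x) + Complex.exp (Complex.I * x * (√3 : ℝ)) =
      ((2 * Real.cosh x : ℝ) : ℂ) * (1 + X) := by
    rw [mul_add, hXdef, mul_div_cancel₀ _ hC0, mul_one]
    push_cast
    rw [Complex.cosh]
    ring
  rw [cubicKernel, hbase, div_eq_mul_inv, ← Complex.cpow_neg,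
    -- a positive real factor splits off the principal branch without a jump of the argument
    Complex.cpow_def_of_ne_zero (mul_ne_zero hC0 h1X), Complex.log_ofReal_mul hC h1X,
    add_mul, Complex.exp_add, Complex.ofReal_log hC.le, ← Complex.cpow_def_of_ne_zero hC0,
    ← Complex.cpow_def_of_ne_zero h1X]

theorem hasSum_cubicKernelTerm (b x : ℝ) :
    HasSum (fun k => cubicKernelTerm b k x) (cubicKernel b x) := by
  have h := (Complex.hasSum_choose_mul_neg_pow (3 * b)
    ((norm_exp_div_two_cosh_le x).trans_lt (by norm_num))).mul_left
    (Complex.exp (Complex.I * x * b * (√3 : ℝ)) *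
      ((2 * Real.cosh x : ℝ) : ℂ) ^ (-(3 * b : ℂ)))
  rw [cubicKernel_eq, ← mul_assoc]
  refine h.congr_fun fun k => ?_
  have hC0 : ((2 * Real.cosh x : ℝ) : ℂ) ≠ 0 := by
    exact_mod_cast (by positivity : 2 * Real.cosh x ≠ 0)
  have e : Complex.exp (√3 * Complex.I * (k + b) * x) =
      Complex.exp (Complex.I * x * b * (√3 : ℝ)) * Complex.exp (Complex.I * x * (√3 : ℝ)) ^ k := by
    rw [← Complex.exp_nat_mul, ← Complex.exp_add]
    ring_nf
  rw [cubicKernelTerm, e, neg_add, Complex.cpow_add _ _ hC0, Complex.cpow_neg _ (k : ℂ),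
    Complex.cpow_natCast, neg_pow (_ / _ : ℂ), div_pow]
  ring

/-- The ratio of the binomial expansion has modulus at most `1 / 2`, since `2 ≤ 2 * cosh x`. -/
theorem norm_cubicKernelTerm_le (b x : ℝ) (k : ℕ) :
    ‖cubicKernelTerm b k x‖ ≤
      |Ring.choose (3 * b + k - 1) k * (1 / 2) ^ k| * (2 * Real.cosh x) ^ (-(3 * b)) := by
  have hC : 0 < 2 * Real.cosh x := by positivity
  have e1 : Complex.exp (√3 * Complex.I * (k + b) * x) =
      Complex.exp (Complex.I * (((k + b) * x : ℝ) : ℂ) * (√3 : ℝ)) := by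
    push_cast; ring_nf
  have e2 : Ring.choose (3 * b + k - 1 : ℂ) k = ((Ring.choose (3 * b + k - 1) k : ℝ) : ℂ) := by
    rw [Complex.ofReal_choose]; push_cast; rfl
  have e3 : ((2 * Real.cosh x : ℝ) : ℂ) ^ (-(3 * b + k : ℂ)) =
      (((2 * Real.cosh x) ^ (-(3 * b)) * ((2 * Real.cosh x) ^ k)⁻¹ : ℝ) : ℂ) := by
    rw [← Real.rpow_natCast, ← Real.rpow_neg hC.le, ← Real.rpow_add hC,
      Complex.ofReal_cpow hC.le]
    push_cast
    ring_nf
  rw [cubicKernelTerm, e1, e2, e3, norm_mul, norm_mul, norm_mul, norm_exp_I_mul_mul, norm_pow,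
    norm_neg, norm_one, one_pow, one_mul, one_mul, Complex.norm_real, Complex.norm_real,
    Real.norm_eq_abs, abs_mul, Real.norm_of_nonneg (by positivity), mul_assoc,
    mul_comm (_ ^ (-(3 * b)))]
  gcongr
  rw [abs_of_nonneg (by positivity), one_div, inv_pow]
  gcongr
  exact two_le_two_cosh x

theorem continuous_cubicKernelTerm (b : ℝ) (k : ℕ) : Continuous (cubicKernelTerm b k) := by
  refine continuous_const.mul (Continuous.mul (by fun_prop) ?_)
  refine Continuous.cpow (by fun_prop) continuous_const fun x => ?_
  exact Complex.ofReal_mem_slitPlane.2 (by positivity)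

theorem integrable_cubicKernelTerm {b : ℝ} (hb : 0 < b) (k : ℕ) :
    Integrable (cubicKernelTerm b k) :=
  ((integrable_two_cosh_rpow_neg (by positivity : 0 < 3 * b)).const_mul _).mono'
    (continuous_cubicKernelTerm b k).aestronglyMeasurable
    (ae_of_all _ fun x => norm_cubicKernelTerm_le b x k)

theorem summable_integral_norm_cubicKernelTerm {b : ℝ} (hb : 0 < b) :
    Summable fun k => ∫ x, ‖cubicKernelTerm b k x‖ := by
  have hs := (Real.summable_choose_mul_pow (s := 3 * b) (r := 1 / 2) (by norm_num)
    (by norm_num)).abs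
  refine Summable.of_nonneg_of_le (fun k => integral_nonneg fun x => norm_nonneg _) (fun k => ?_)
    (hs.mul_right (∫ x : ℝ, (2 * Real.cosh x) ^ (-(3 * b))))
  rw [← integral_const_mul]
  exact integral_mono (integrable_cubicKernelTerm hb k).norm
    ((integrable_two_cosh_rpow_neg (by positivity)).const_mul _)
    fun x => norm_cubicKernelTerm_le b x k

theorem integrable_cubicKernel {b : ℝ} (hb : 0 < b) : Integrable (cubicKernel b) := by
  have hs := (Real.summable_choose_mul_pow (s := 3 * b) (r := 1 / 2) (by norm_num)
    (by norm_num)).abs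
  have hm : AEStronglyMeasurable (cubicKernel b) := by
    refine aestronglyMeasurable_of_tendsto_ae atTop
      (f := fun n x => ∑ k ∈ Finset.range n, cubicKernelTerm b k x) (fun n => ?_)
      (ae_of_all _ fun x => (hasSum_cubicKernelTerm b x).tendsto_sum_nat)
    exact (continuous_finsetSum _ fun k _ => continuous_cubicKernelTerm b k).aestronglyMeasurable
  refine ((integrable_two_cosh_rpow_neg (by positivity : 0 < 3 * b)).const_mul
    (∑' k : ℕ, |Ring.choose (3 * b + k - 1) k * (1 / 2) ^ k|)).mono' hm (ae_of_all _ fun x => ?_)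
  rw [← (hasSum_cubicKernelTerm b x).tsum_eq, ← tsum_mul_right]
  exact tsum_of_norm_bounded (hs.mul_right _).hasSum fun k => norm_cubicKernelTerm_le b x k

/-- The Beta integral evaluates the terms of the binomial expansion. -/
theorem two_mul_Gamma_mul_integral_cubicKernelTerm {b : ℝ} (hb : 0 < b) (k : ℕ) :
    2 * Complex.Gamma (3 * b) * ∫ x, cubicKernelTerm b k x =
      (-1) ^ k / k.factorial *
        (Complex.Gamma (cubicNode b k) * Complex.Gamma (starRingEnd ℂ (cubicNode b k))) := by
  have hu : 0 < (cubicNode b k).re := by rw [cubicNode_re]; positivity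
  have hbeta := Complex.Gamma_mul_Gamma_eq_betaIntegral hu
    (t := starRingEnd ℂ (cubicNode b k)) (by rwa [Complex.conj_re])
  rw [betaIntegral_eq_integral_two_cosh, cubicNode_add_conj, cubicNode_sub_conj] at hbeta
  have hch := Complex.choose_mul_Gamma (3 * b) (fun m h => by
    have h' := congrArg Complex.re h
    simp at h'
    have : (0 : ℝ) ≤ m := m.cast_nonneg
    linarith) k
  simp only [cubicKernelTerm]
  rw [hbeta, integral_const_mul]
  linear_combination (2 * (-1) ^ k * ∫ x : ℝ, Complex.exp (√3 * Complex.I * (k + b) * x) *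
      ((2 * Real.cosh x : ℝ) : ℂ) ^ (-(3 * b + k : ℂ))) * hch

/-- The limits of the partial fraction coefficients form an absolutely convergent series, whose
sum is an explicit multiple of the integral of the kernel. -/
theorem hasSum_cubicCoeff_limit {b : ℝ} (hb : 0 < b) :
    HasSum (fun k : ℕ => ((-1) ^ k / k.factorial * (Complex.Gamma (cubicNode b k) *
        Complex.Gamma (starRingEnd ℂ (cubicNode b k)) / Complex.Gamma b ^ 3)))
      (2 * Complex.Gamma (3 * b) / Complex.Gamma b ^ 3 * ∫ x, cubicKernel b x) := by
  have h := (hasSum_integral_of_summable_integral_norm (integrable_cubicKernelTerm hb)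
    (summable_integral_norm_cubicKernelTerm hb)).mul_left
    (2 * Complex.Gamma (3 * b) / Complex.Gamma b ^ 3)
  simp only [(hasSum_cubicKernelTerm b _).tsum_eq] at h
  refine h.congr_fun fun k => ?_
  linear_combination
    -(1 / Complex.Gamma b ^ 3) * two_mul_Gamma_mul_integral_cubicKernelTerm hb k

/-! ### The infinite product and its reciprocal -/

theorem multipliable_one_add_cube_div {b : ℝ} (hb : 0 < b) (x : ℝ) :
    Multipliable (fun k : ℕ => 1 + x ^ 3 / ((k : ℝ) + b) ^ 3) := by
  refine Real.multipliable_one_add_of_summable ?_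
  have h := (Real.summable_nat_pow_inv (p := 3)).2 (by norm_num)
  rw [← summable_nat_add_iff 1] at h
  rw [← summable_nat_add_iff 1]
  refine Summable.of_norm_bounded (h.mul_left |x ^ 3|) fun k => ?_
  have hk : ((k + 1 : ℕ) : ℝ) ≤ ((k + 1 : ℕ) : ℝ) + b := by linarith
  rw [norm_div, Real.norm_eq_abs, Real.norm_of_nonneg (by positivity), div_eq_mul_inv]
  gcongr

theorem one_add_cube_div_le_prod {b x : ℝ} (hb : 0 < b) (hx : 0 ≤ x) (M : ℕ) :
    1 + x ^ 3 / b ^ 3 ≤ ∏ k ∈ Finset.range (M + 1), (1 + x ^ 3 / ((k : ℝ) + b) ^ 3) := by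
  rw [Finset.prod_range_succ']
  simp only [Nat.cast_zero, zero_add]
  refine le_mul_of_one_le_left (by positivity) (Finset.one_le_prod fun k _ => ?_)
  have : 0 ≤ x ^ 3 / (((k + 1 : ℕ) : ℝ) + b) ^ 3 := by positivity
  linarith

theorem tendsto_inv_prod_one_add_cube_div {b x : ℝ} (hb : 0 < b) (hx : 0 ≤ x) :
    Tendsto (fun M => (∏ k ∈ Finset.range (M + 1), (1 + x ^ 3 / ((k : ℝ) + b) ^ 3))⁻¹) atTop
      (𝓝 (1 / ∏' k : ℕ, (1 + x ^ 3 / ((k : ℝ) + b) ^ 3))) := by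
  have h := ((multipliable_one_add_cube_div hb x).hasProd.tendsto_prod_nat).comp
    (tendsto_add_atTop_nat 1)
  have hpos : 0 < 1 + x ^ 3 / b ^ 3 := by positivity
  rw [one_div]
  exact h.inv₀ (hpos.trans_le (ge_of_tendsto' h fun M => one_add_cube_div_le_prod hb hx M)).ne'

theorem norm_inv_prod_one_add_cube_div_le {b x : ℝ} (hb : 0 < b) (hx : 0 ≤ x) (M : ℕ) :
    ‖(∏ k ∈ Finset.range (M + 1), (1 + x ^ 3 / ((k : ℝ) + b) ^ 3))⁻¹‖ ≤
      (1 + x ^ 3 / b ^ 3)⁻¹ := by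
  have hpos : 0 < 1 + x ^ 3 / b ^ 3 := by positivity
  have h := one_add_cube_div_le_prod hb hx M
  rw [Real.norm_of_nonneg (inv_nonneg.2 (hpos.le.trans h))]
  gcongr

theorem aestronglyMeasurable_inv_prod (b : ℝ) (M : ℕ) (μ : Measure ℝ) :
    AEStronglyMeasurable
      (fun x : ℝ => (∏ k ∈ Finset.range M, (1 + x ^ 3 / ((k : ℝ) + b) ^ 3))⁻¹) μ := by
  have : Continuous fun x : ℝ => ∏ k ∈ Finset.range M, (1 + x ^ 3 / ((k : ℝ) + b) ^ 3) :=
    continuous_finsetProd _ fun k _ => by fun_prop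
  exact this.measurable.inv.aestronglyMeasurable

theorem integrableOn_inv_tprod {b : ℝ} (hb : 0 < b) :
    IntegrableOn (fun x : ℝ => 1 / ∏' k : ℕ, (1 + x ^ 3 / ((k : ℝ) + b) ^ 3)) (Set.Ioi 0) := by
  refine (integrableOn_inv_one_add_cube_div hb).mono' ?_ ?_
  · refine aestronglyMeasurable_of_tendsto_ae atTop
      (fun M => aestronglyMeasurable_inv_prod b (M + 1) _) ?_
    filter_upwards [ae_restrict_mem measurableSet_Ioi] with x hx
    exact tendsto_inv_prod_one_add_cube_div hb (le_of_lt hx)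
  · filter_upwards [ae_restrict_mem measurableSet_Ioi] with x hx
    exact le_of_tendsto' (tendsto_inv_prod_one_add_cube_div hb (le_of_lt hx)).norm
      fun M => norm_inv_prod_one_add_cube_div_le hb (le_of_lt hx) M

theorem tendsto_integral_inv_prod {b : ℝ} (hb : 0 < b) :
    Tendsto (fun M => ∫ x in Set.Ioi (0 : ℝ),
        (∏ k ∈ Finset.range (M + 1), (1 + x ^ 3 / ((k : ℝ) + b) ^ 3))⁻¹) atTop
      (𝓝 (∫ x in Set.Ioi (0 : ℝ), 1 / ∏' k : ℕ, (1 + x ^ 3 / ((k : ℝ) + b) ^ 3))) := by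
  refine tendsto_integral_of_dominated_convergence _
    (fun M => aestronglyMeasurable_inv_prod b (M + 1) _) (integrableOn_inv_one_add_cube_div hb)
    (fun M => ?_) ?_
  · filter_upwards [ae_restrict_mem measurableSet_Ioi] with x hx
    exact norm_inv_prod_one_add_cube_div_le hb (le_of_lt hx) M
  · filter_upwards [ae_restrict_mem measurableSet_Ioi] with x hx
    exact tendsto_inv_prod_one_add_cube_div hb (le_of_lt hx)

/-! ### Passage to the limit in the partial fraction expansion -/

theorem inv_prod_eq_sum_cubicCoeff {b x : ℝ} (hb : 0 < b) (hx : 0 ≤ x) (M : ℕ) :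
    (∏ k ∈ Finset.range (M + 1), (1 + x ^ 3 / ((k : ℝ) + b) ^ 3))⁻¹ =
      ∑ k ∈ Finset.range (M + 1), cubicCoeff b (M + 1) k * (1 + x ^ 3 / ((k : ℝ) + b) ^ 3)⁻¹ := by
  have hpos : ∀ k : ℕ, 0 < ((k : ℝ) + b) ^ 3 := fun k => by positivity
  have hinj : Function.Injective fun k : ℕ => ((k : ℝ) + b) ^ 3 := by
    intro i j hij
    have hij' := (pow_left_inj₀ (by positivity) (by positivity) three_ne_zero).1 hij
    exact_mod_cast add_right_cancel hij'
  have h := inv_prod_one_sub_div_eq_sum hinj (fun k => (hpos k).ne')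
    (Finset.nonempty_range_iff.2 M.succ_ne_zero) (w := -x ^ 3) (fun k => by
      have : 0 ≤ x ^ 3 := by positivity
      linarith [hpos k])
  simp only [neg_div, sub_neg_eq_add] at h
  exact h

theorem integral_inv_prod {b : ℝ} (hb : 0 < b) (M : ℕ) :
    ∫ x in Set.Ioi (0 : ℝ), (∏ k ∈ Finset.range (M + 1), (1 + x ^ 3 / ((k : ℝ) + b) ^ 3))⁻¹ =
      2 * Real.pi / √3 *
        ∑ k ∈ Finset.range (M + 1), cubicCoeff b (M + 1) k * ((k : ℝ) + b) / 3 := by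
  rw [setIntegral_congr_fun measurableSet_Ioi fun x hx =>
      inv_prod_eq_sum_cubicCoeff hb (le_of_lt hx) M,
    integral_finsetSum _ fun k _ =>
      (integrableOn_inv_one_add_cube_div (by positivity)).const_mul _, Finset.mul_sum]
  refine Finset.sum_congr rfl fun k _ => ?_
  rw [integral_const_mul, integral_inv_one_add_cube_div (by positivity)]
  field_simp

/-- Tannery's theorem: each coefficient is dominated by its limit. -/
theorem tendsto_sum_cubicCoeff {b : ℝ} (hb : 0 < b) :
    Tendsto (fun M => ∑ k ∈ Finset.range M, (cubicCoeff b M k : ℂ) * (k + b) / 3) atTop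
      (𝓝 (2 * Complex.Gamma (3 * b) / Complex.Gamma b ^ 3 * ∫ x, cubicKernel b x)) := by
  have hsum := hasSum_cubicCoeff_limit hb
  rw [← hsum.tsum_eq]
  have h := tendsto_tsum_of_dominated_convergence (𝓕 := atTop)
    (f := fun M k => if k < M then (cubicCoeff b M k : ℂ) * (k + b) / 3 else 0)
    (g := fun k => (-1) ^ k / k.factorial * (Complex.Gamma (cubicNode b k) *
        Complex.Gamma (starRingEnd ℂ (cubicNode b k)) / Complex.Gamma b ^ 3))
    hsum.summable.norm (fun k => ?_) (Eventually.of_forall fun M k => ?_)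
  · refine h.congr fun M => ?_
    rw [tsum_eq_sum (s := Finset.range M) fun k hk => if_neg (by simpa using hk)]
    exact Finset.sum_congr rfl fun k hk => if_pos (Finset.mem_range.1 hk)
  · refine (tendsto_cubicCoeff hb k).congr' ?_
    filter_upwards [eventually_gt_atTop k] with M hM
    rw [if_pos hM]
  · split_ifs with hk
    · exact norm_cubicCoeff_le hb hk
    · rw [norm_zero]
      exact norm_nonneg _

theorem integral_inv_tprod_eq {b : ℝ} (hb : 0 < b) :
    ((∫ x in Set.Ioi (0 : ℝ), 1 / ∏' k : ℕ, (1 + x ^ 3 / ((k : ℝ) + b) ^ 3) : ℝ) : ℂ) =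
      ((4 * Real.pi * Real.Gamma (3 * b) / (Real.Gamma b ^ 3 * √3) : ℝ) : ℂ) *
        ∫ x : ℝ, cubicKernel b x := by
  have h1 := (Complex.continuous_ofReal.tendsto _).comp (tendsto_integral_inv_prod hb)
  have h2 := ((tendsto_sum_cubicCoeff hb).comp (tendsto_add_atTop_nat 1)).const_mul
    ((2 * Real.pi / √3 : ℝ) : ℂ)
  refine (tendsto_nhds_unique h1 (h2.congr fun M => ?_)).trans ?_
  · simp only [Function.comp, integral_inv_prod hb]
    push_cast
    rfl
  · have e : (3 * b : ℂ) = ((3 * b : ℝ) : ℂ) := by push_cast; rfl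
    rw [← mul_assoc, e, Complex.Gamma_ofReal, Complex.Gamma_ofReal]
    congr 1
    push_cast
    ring

/-! ### Rotation of a contour in a sector -/

/-- The substitution `r = exp t`, from the whole line to the half-line. -/
theorem integral_comp_exp_univ (f : ℝ → ℂ) :
    ∫ t : ℝ, (Real.exp t : ℂ) * f (Real.exp t) = ∫ r in Set.Ioi (0 : ℝ), f r := by
  have h := integral_image_eq_integral_abs_deriv_smul (f := Real.exp) (s := Set.univ)
    MeasurableSet.univ (fun x _ => (Real.hasDerivAt_exp x).hasDerivWithinAt)
    Real.exp_injective.injOn f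
  rw [Set.image_univ, Real.range_exp, setIntegral_univ] at h
  simpa [abs_of_pos (Real.exp_pos _)] using h.symm

theorem integrable_comp_exp_univ {f : ℝ → ℂ} (hf : IntegrableOn f (Set.Ioi 0)) :
    Integrable fun t : ℝ => (Real.exp t : ℂ) * f (Real.exp t) := by
  have h := integrableOn_image_iff_integrableOn_abs_deriv_smul (f := Real.exp) (s := Set.univ)
    MeasurableSet.univ (fun x _ => (Real.hasDerivAt_exp x).hasDerivWithinAt)
    Real.exp_injective.injOn f
  rw [Set.image_univ, Real.range_exp, integrableOn_univ] at h
  simpa [abs_of_pos (Real.exp_pos _)] using h.1 hf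

theorem tendsto_mul_exp_neg_mul_atTop {c : ℝ} (hc : 0 < c) :
    Tendsto (fun r : ℝ => r * Real.exp (-(c * r))) atTop (𝓝 0) := by
  have h := (Real.tendsto_pow_mul_exp_neg_atTop_nhds_zero 1).comp (tendsto_id.const_mul_atTop hc)
  have h' := h.const_mul c⁻¹
  rw [mul_zero] at h'
  refine h'.congr fun r => ?_
  simp only [Function.comp, id, pow_one]
  field_simp

theorem integrableOn_ray {f : ℂ → ℂ} {z : ℂ} {C c : ℝ} (hc : 0 < c)
    (hf : ∀ r : ℝ, 0 < r → DifferentiableAt ℂ f (r * z))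
    (hbound : ∀ r : ℝ, 0 < r → ‖f (r * z)‖ ≤ C * Real.exp (-(c * r))) :
    IntegrableOn (fun r : ℝ => f (r * z)) (Set.Ioi 0) := by
  have hcont : ContinuousOn (fun r : ℝ => f (r * z)) (Set.Ioi 0) := fun r hr =>
    (ContinuousAt.comp (g := f) (f := fun r : ℝ => (r : ℂ) * z) (hf r hr).continuousAt
      (by fun_prop)).continuousWithinAt
  have hexp := (integrableOn_exp_mul_Ioi (neg_neg_of_pos hc) 0).const_mul C
  refine hexp.mono' (hcont.aestronglyMeasurable measurableSet_Ioi) ?_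
  filter_upwards [ae_restrict_mem measurableSet_Ioi] with r hr
  simpa using hbound r hr

/-- Rotation of the contour: the integrals of an exponentially decaying holomorphic function along
the two boundary rays of a sector agree. The logarithm carries the sector to a strip, where
Cauchy's theorem for rectangles applies. -/
theorem integral_Ioi_eq_integral_ray {f : ℂ → ℂ} {θ C c : ℝ} (hθ : 0 ≤ θ) (hc : 0 < c)
    (hf : ∀ r : ℝ, 0 < r → ∀ w ∈ Set.Icc 0 θ,
      DifferentiableAt ℂ f (r * Complex.exp (w * Complex.I)))
    (hbound : ∀ r : ℝ, 0 < r → ∀ w ∈ Set.Icc 0 θ,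
      ‖f (r * Complex.exp (w * Complex.I))‖ ≤ C * Real.exp (-(c * r))) :
    ∫ r in Set.Ioi (0 : ℝ), f r =
      Complex.exp (θ * Complex.I) *
        ∫ r in Set.Ioi (0 : ℝ), f (r * Complex.exp (θ * Complex.I)) := by
  set g : ℂ → ℂ := fun ζ => Complex.exp ζ * f (Complex.exp ζ) with hg
  have hexp : ∀ t w : ℝ, Complex.exp (t + w * Complex.I) =
      (Real.exp t : ℂ) * Complex.exp (w * Complex.I) := fun t w => by
    rw [Complex.exp_add, Complex.ofReal_exp]
  have hgd : ∀ t : ℝ, ∀ w ∈ Set.Icc 0 θ, DifferentiableAt ℂ g (t + w * Complex.I) := by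
    intro t w hw
    refine Complex.differentiableAt_exp.mul (DifferentiableAt.comp _ ?_ Complex.differentiableAt_exp)
    rw [hexp]
    exact hf _ (Real.exp_pos t) w hw
  have hgb : ∀ t : ℝ, ∀ w ∈ Set.Icc 0 θ, ‖g (t + w * Complex.I)‖ ≤
      C * (Real.exp t * Real.exp (-(c * Real.exp t))) := by
    intro t w hw
    have := hbound _ (Real.exp_pos t) w hw
    rw [hg]
    simp only [hexp, norm_mul, Complex.norm_exp_ofReal_mul_I, Complex.norm_real, mul_one,
      Real.norm_of_nonneg (Real.exp_pos t).le]
    calc _ ≤ Real.exp t * (C * Real.exp (-(c * Real.exp t))) := by gcongr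
      _ = _ := by ring
  have hside : ∀ w ∈ Set.Icc 0 θ,
      Integrable (fun t : ℝ => g (t + w * Complex.I)) ∧
      ∫ t : ℝ, g (t + w * Complex.I) = Complex.exp (w * Complex.I) *
        ∫ r in Set.Ioi (0 : ℝ), f (r * Complex.exp (w * Complex.I)) := by
    intro w hw
    have e : (fun t : ℝ => g (t + w * Complex.I)) = fun t : ℝ => Complex.exp (w * Complex.I) *
        ((Real.exp t : ℂ) * f ((Real.exp t : ℂ) * Complex.exp (w * Complex.I))) := by
      funext t
      rw [hg]
      simp only [hexp]
      ring
    rw [e, integral_const_mul,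
      integral_comp_exp_univ fun r : ℝ => f (r * Complex.exp (w * Complex.I))]
    exact ⟨(integrable_comp_exp_univ (f := fun r : ℝ => f (r * Complex.exp (w * Complex.I)))
      (integrableOn_ray hc (fun r hr => hf r hr w hw) fun r hr => hbound r hr w hw)).const_mul _,
      rfl⟩
  have h0 : (0 : ℝ) ∈ Set.Icc 0 θ := ⟨le_rfl, hθ⟩
  have h1 : θ ∈ Set.Icc 0 θ := ⟨hθ, le_rfl⟩
  have hrect : ∀ T : ℝ,
      (∫ t in (-T)..T, g (t + (0 : ℝ) * Complex.I)) - (∫ t in (-T)..T, g (t + θ * Complex.I)) +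
        Complex.I * (∫ w in (0 : ℝ)..θ, g (T + w * Complex.I)) -
        Complex.I * (∫ w in (0 : ℝ)..θ, g ((-T : ℝ) + w * Complex.I)) = 0 := by
    intro T
    have h := Complex.integral_boundary_rect_eq_zero_of_differentiableOn g
      (⟨-T, 0⟩ : ℂ) (⟨T, θ⟩ : ℂ) (fun z hz => by
        have hz2 : z.im ∈ Set.Icc 0 θ := by
          have := (Complex.mem_reProdIm.1 hz).2
          rwa [Set.uIcc_of_le hθ] at this
        have := hgd z.re z.im hz2
        rw [Complex.re_add_im] at this
        exact this.differentiableWithinAt)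
    simpa only [smul_eq_mul] using h
  have hvert : ∀ T : ℝ, ‖∫ w in (0 : ℝ)..θ, g (T + w * Complex.I)‖ ≤
      C * (Real.exp T * Real.exp (-(c * Real.exp T))) * |θ - 0| := fun T =>
    intervalIntegral.norm_integral_le_of_norm_le_const fun w hw => by
      rw [Set.uIoc_of_le hθ] at hw
      exact hgb T w ⟨hw.1.le, hw.2⟩
  have hv1 : Tendsto (fun T : ℝ => ∫ w in (0 : ℝ)..θ, g (T + w * Complex.I)) atTop (𝓝 0) := by
    refine squeeze_zero_norm hvert ?_
    have := (((tendsto_mul_exp_neg_mul_atTop hc).comp Real.tendsto_exp_atTop).const_mul C).mul_const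
      |θ - 0|
    simpa using this
  have hv2 : Tendsto (fun T : ℝ => ∫ w in (0 : ℝ)..θ, g ((-T : ℝ) + w * Complex.I)) atTop
      (𝓝 0) := by
    refine squeeze_zero_norm (fun T => hvert (-T)) ?_
    have hcont : Tendsto (fun r : ℝ => r * Real.exp (-(c * r))) (𝓝 0) (𝓝 0) := by
      have : Continuous fun r : ℝ => r * Real.exp (-(c * r)) := by fun_prop
      simpa using this.tendsto 0
    have := ((hcont.comp (Real.tendsto_exp_atBot.comp tendsto_neg_atTop_atBot)).const_mul C).mul_const
      |θ - 0|
    simpa [Function.comp_def] using this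
  have hlim := (((intervalIntegral_tendsto_integral (hside 0 h0).1 tendsto_neg_atTop_atBot
    tendsto_id).sub (intervalIntegral_tendsto_integral (hside θ h1).1 tendsto_neg_atTop_atBot
    tendsto_id)).add (hv1.const_mul Complex.I)).sub (hv2.const_mul Complex.I)
  have hzero := tendsto_nhds_unique hlim (tendsto_const_nhds.congr fun T => (hrect T).symm)
  rw [(hside 0 h0).2, (hside θ h1).2] at hzero
  simpa [sub_eq_zero] using hzero

/-! ### The case `b = 1` -/

/-- The holomorphic function whose restriction to the real line is the kernel for `b = 1`. -/
noncomputable def sectorKernel (z : ℂ) : ℂ :=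
  Complex.exp ((√3 : ℝ) * Complex.I * z) /
    (Complex.exp z + Complex.exp (-z) + Complex.exp ((√3 : ℝ) * Complex.I * z)) ^ 3

theorem cubicKernel_one (x : ℝ) : cubicKernel 1 x = sectorKernel x := by
  have e : Complex.I * x * (√3 : ℝ) = (√3 : ℝ) * Complex.I * x := by ring
  have h3 : (3 * ((1 : ℝ) : ℂ)) = ((3 : ℕ) : ℂ) := by norm_num
  rw [cubicKernel, sectorKernel, h3, Complex.cpow_natCast, Complex.ofReal_one, mul_one, e]

/-- In the sector `0 ≤ arg z ≤ π / 6` the term `exp z` dominates: for large `re z` by size, and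
for small `re z` because the other two terms, divided by `exp z`, have nonnegative real part. -/
theorem exp_re_div_four_le_norm {z : ℂ} (h0 : 0 ≤ z.im) (h1 : √3 * z.im ≤ z.re) :
    Real.exp z.re / 4 ≤
      ‖Complex.exp z + Complex.exp (-z) + Complex.exp ((√3 : ℝ) * Complex.I * z)‖ := by
  obtain ⟨x, y⟩ := z
  simp only at h0 h1
  have hs0 : (0 : ℝ) < √3 := by positivity
  have hs : √3 * √3 = 3 := Real.mul_self_sqrt (by norm_num)
  have hs1 : (1 : ℝ) ≤ √3 := by nlinarith
  have hs2 : √3 ≤ (2 : ℝ) := by nlinarith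
  have hs3 : (1.7 : ℝ) ≤ √3 := by nlinarith
  set p : ℂ := -2 * ⟨x, y⟩ with hp
  set q : ℂ := ((√3 : ℝ) * Complex.I - 1) * ⟨x, y⟩ with hq
  have hpre : p.re = -2 * x := by simp [hp]
  have hpim : p.im = -2 * y := by simp [hp]
  have hqre : q.re = -x - √3 * y := by simp [hq]
  have hqim : q.im = √3 * x - y := by simp [hq]; ring
  have hfac : Complex.exp ⟨x, y⟩ + Complex.exp (-⟨x, y⟩) +
      Complex.exp ((√3 : ℝ) * Complex.I * ⟨x, y⟩) =
      Complex.exp ⟨x, y⟩ * (1 + Complex.exp p + Complex.exp q) := by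
    rw [mul_add, mul_add, ← Complex.exp_add, ← Complex.exp_add, mul_one, hp, hq]
    ring_nf
  have key : 1 / 4 ≤ ‖1 + Complex.exp p + Complex.exp q‖ := by
    have hy : √3 * y ≥ 0 := by positivity
    have hx : 0 ≤ x := hy.trans h1
    -- at `x = log 2 < 0.7` the size estimate gives way to the estimate of the arguments
    rcases le_total (Real.exp (-x)) (1 / 2) with hle | hge
    · have hP : ‖Complex.exp p‖ ≤ 1 / 4 := by
        rw [Complex.norm_exp, hpre, show -2 * x = -x + -x by ring, Real.exp_add]
        nlinarith [Real.exp_pos (-x)]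
      have hQ : ‖Complex.exp q‖ ≤ 1 / 2 := by
        rw [Complex.norm_exp, hqre]
        exact (Real.exp_le_exp.2 (by linarith)).trans hle
      have t1 := norm_sub_le (1 + Complex.exp p + Complex.exp q) (Complex.exp q)
      have t2 := norm_sub_le (1 + Complex.exp p) (Complex.exp p)
      rw [add_sub_cancel_right] at t1 t2
      rw [norm_one] at t2
      linarith
    · have hx2 : x ≤ 0.7 := by
        have h := Real.log_le_log (by norm_num) hge
        rw [Real.log_exp, one_div, Real.log_inv] at h
        linarith [Real.log_two_lt_d9]
      have hpi := Real.pi_gt_three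
      have hP : 0 ≤ (Complex.exp p).re := by
        rw [Complex.exp_re, hpim]
        refine mul_nonneg (Real.exp_pos _).le (Real.cos_nonneg_of_neg_pi_div_two_le_of_le ?_ ?_)
        · nlinarith
        · nlinarith
      have hQ : 0 ≤ (Complex.exp q).re := by
        rw [Complex.exp_re, hqim]
        refine mul_nonneg (Real.exp_pos _).le (Real.cos_nonneg_of_neg_pi_div_two_le_of_le ?_ ?_)
        · nlinarith
        · nlinarith
      refine le_trans ?_ (Complex.re_le_norm _)
      simp only [Complex.add_re, Complex.one_re]
      linarith
  rw [hfac, norm_mul, Complex.norm_exp, div_eq_mul_one_div]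
  gcongr

theorem differentiableAt_sectorKernel {z : ℂ} (h0 : 0 ≤ z.im) (h1 : √3 * z.im ≤ z.re) :
    DifferentiableAt ℂ sectorKernel z := by
  have h : 0 < ‖Complex.exp z + Complex.exp (-z) + Complex.exp ((√3 : ℝ) * Complex.I * z)‖ :=
    (by positivity : 0 < Real.exp z.re / 4).trans_le (exp_re_div_four_le_norm h0 h1)
  exact DifferentiableAt.div (by fun_prop) (by fun_prop) (pow_ne_zero 3 (norm_pos_iff.1 h))

theorem norm_sectorKernel_le {z : ℂ} (h0 : 0 ≤ z.im) (h1 : √3 * z.im ≤ z.re) :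
    ‖sectorKernel z‖ ≤ 64 * Real.exp (-(3 * z.re)) := by
  have h := exp_re_div_four_le_norm h0 h1
  have hnum : ‖Complex.exp ((√3 : ℝ) * Complex.I * z)‖ ≤ 1 := by
    rw [Complex.norm_exp, Real.exp_le_one_iff]
    simp
    positivity
  rw [sectorKernel, norm_div, norm_pow]
  calc _ ≤ 1 / (Real.exp z.re / 4) ^ 3 := by gcongr
    _ = 64 * Real.exp (-(3 * z.re)) := by
      rw [div_pow, ← Real.exp_nat_mul, Real.exp_neg]
      push_cast
      field_simp
      norm_num

theorem two_cos_add_exp_pos_bound {r : ℝ} (hr : 0 ≤ r) :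
    Real.exp (r * √3) / 2 ≤ 2 * Real.cos r + Real.exp (r * √3) := by
  have hs3 : (1.7 : ℝ) ≤ √3 := by
    nlinarith [Real.mul_self_sqrt (by norm_num : (0:ℝ) ≤ 3), Real.sqrt_nonneg 3]
  rcases le_total r (3 / 2) with h | h
  · have : 0 ≤ Real.cos r := Real.cos_nonneg_of_neg_pi_div_two_le_of_le
      (by linarith [Real.pi_pos]) (by linarith [Real.pi_gt_d2])
    linarith [Real.exp_pos (r * √3)]
  · have h1 : 4 ≤ Real.exp (r * √3) := by
      have h2 : (2.5 : ℝ) ≤ r * √3 := by nlinarith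
      have h3 := Real.quadratic_le_exp_of_nonneg (by linarith : 0 ≤ r * √3)
      nlinarith
    linarith [Real.neg_one_le_cos r]

theorem integrableOn_exp_div_two_cos :
    IntegrableOn
      (fun x : ℝ => Real.exp (x * √3) / (2 * Real.cos x + Real.exp (x * √3)) ^ 3)
      (Set.Ioi 0) := by
  have hexp :=
    (integrableOn_exp_mul_Ioi (neg_neg_of_pos (by positivity : 0 < 2 * √3)) 0).const_mul 8
  refine hexp.mono' (Measurable.aestronglyMeasurable (by fun_prop)) ?_
  filter_upwards [ae_restrict_mem measurableSet_Ioi] with x hx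
  have h := two_cos_add_exp_pos_bound (le_of_lt hx)
  have hpos : 0 < 2 * Real.cos x + Real.exp (x * √3) :=
    (by positivity : 0 < Real.exp (x * √3) / 2).trans_le h
  rw [Real.norm_of_nonneg (by positivity)]
  calc _ ≤ Real.exp (x * √3) / (Real.exp (x * √3) / 2) ^ 3 := by gcongr
    _ = 8 * Real.exp (-(2 * √3) * x) := by
      rw [show -(2 * √3) * x = -(x * √3) + -(x * √3) by ring, Real.exp_add, Real.exp_neg]
      field_simp
      norm_num

theorem exp_pi_div_six_mul_I :
    Complex.exp ((Real.pi / 6 : ℝ) * Complex.I) = (√3 / 2 : ℝ) + (1 / 2 : ℝ) * Complex.I := by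
  rw [Complex.exp_mul_I, ← Complex.ofReal_cos, ← Complex.ofReal_sin, Real.cos_pi_div_six,
    Real.sin_pi_div_six]

/-- On the ray `arg z = π / 6` the kernel is real. -/
theorem sectorKernel_ray (r : ℝ) :
    sectorKernel (r * Complex.exp ((Real.pi / 6 : ℝ) * Complex.I)) =
      ((Real.exp (r * √3) / (2 * Real.cos r + Real.exp (r * √3)) ^ 3 : ℝ) : ℂ) := by
  rw [exp_pi_div_six_mul_I]
  set z : ℂ := r * ((√3 / 2 : ℝ) + (1 / 2 : ℝ) * Complex.I) with hz
  have hI := Complex.I_sq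
  have h3 : ((√3 : ℝ) : ℂ) ^ 2 = 3 := by
    rw [← Complex.ofReal_pow, Real.sq_sqrt (by norm_num)]; norm_num
  -- the common factor of the three exponentials in the denominator
  set w : ℂ := r * (Complex.I - (√3 : ℝ)) / 2 with hw
  have e1 : z = w + (r * √3 : ℝ) := by rw [hz, hw]; push_cast; ring
  have e2 : -z = w + -(r * Complex.I) := by rw [hz, hw]; push_cast; ring
  have e3 : (√3 : ℝ) * Complex.I * z = w + r * Complex.I := by
    rw [hz, hw]; push_cast
    linear_combination (r * Complex.I / 2) * h3 + (r * (√3 : ℝ) / 2) * hI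
  have e4 : (√3 : ℝ) * Complex.I * z = (3 : ℕ) * w + (r * √3 : ℝ) := by
    rw [e3, hw]; push_cast; ring
  have hbase : Complex.exp z + Complex.exp (-z) + Complex.exp ((√3 : ℝ) * Complex.I * z) =
      Complex.exp w * ((2 * Real.cos r + Real.exp (r * √3) : ℝ) : ℂ) := by
    rw [e3, e2, e1, Complex.exp_add, Complex.exp_add, Complex.exp_add]
    push_cast
    rw [Complex.cos, neg_mul]
    ring
  rw [sectorKernel, hbase, e4, Complex.exp_add, Complex.exp_nat_mul, mul_pow,
    mul_div_mul_left _ _ (pow_ne_zero 3 (Complex.exp_ne_zero w))]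
  push_cast
  rfl

theorem integral_Ioi_sectorKernel :
    ∫ x in Set.Ioi (0 : ℝ), sectorKernel x =
      Complex.exp ((Real.pi / 6 : ℝ) * Complex.I) *
        ((∫ x in Set.Ioi (0 : ℝ),
          Real.exp (x * √3) / (2 * Real.cos x + Real.exp (x * √3)) ^ 3 : ℝ) : ℂ) := by
  have hpi := Real.pi_pos
  have hre : ∀ r w : ℝ, (r * Complex.exp (w * Complex.I) : ℂ).re = r * Real.cos w := fun r w => by
    rw [Complex.re_ofReal_mul, Complex.exp_ofReal_mul_I_re]
  have him : ∀ r w : ℝ, (r * Complex.exp (w * Complex.I) : ℂ).im = r * Real.sin w := fun r w => by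
    rw [Complex.im_ofReal_mul, Complex.exp_ofReal_mul_I_im]
  have hsin : ∀ w ∈ Set.Icc 0 (Real.pi / 6), 0 ≤ Real.sin w ∧ Real.sin w ≤ 1 / 2 := fun w hw => by
    refine ⟨Real.sin_nonneg_of_nonneg_of_le_pi hw.1 (by linarith [hw.2]), ?_⟩
    rw [← Real.sin_pi_div_six]
    exact Real.sin_le_sin_of_le_of_le_pi_div_two (by linarith [hw.1]) (by linarith) hw.2
  have hcos : ∀ w ∈ Set.Icc 0 (Real.pi / 6), √3 / 2 ≤ Real.cos w := fun w hw => by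
    rw [← Real.cos_pi_div_six]
    exact Real.cos_le_cos_of_nonneg_of_le_pi hw.1 (by linarith) hw.2
  have hsec : ∀ r : ℝ, 0 < r → ∀ w ∈ Set.Icc 0 (Real.pi / 6),
      0 ≤ (r * Complex.exp (w * Complex.I) : ℂ).im ∧
      √3 * (r * Complex.exp (w * Complex.I) : ℂ).im ≤ (r * Complex.exp (w * Complex.I) : ℂ).re := by
    intro r hr w hw
    rw [hre, him]
    refine ⟨mul_nonneg hr.le (hsin w hw).1, ?_⟩
    have : √3 * Real.sin w ≤ Real.cos w := by
      have := mul_le_mul_of_nonneg_left (hsin w hw).2 (Real.sqrt_nonneg 3)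
      linarith [hcos w hw]
    nlinarith
  have h := integral_Ioi_eq_integral_ray (f := sectorKernel) (θ := Real.pi / 6) (C := 64)
    (c := 3 * (√3 / 2)) (by positivity) (by positivity)
    (fun r hr w hw => differentiableAt_sectorKernel (hsec r hr w hw).1 (hsec r hr w hw).2)
    (fun r hr w hw => by
      refine (norm_sectorKernel_le (hsec r hr w hw).1 (hsec r hr w hw).2).trans ?_
      rw [hre]
      have := mul_le_mul_of_nonneg_left (hcos w hw) hr.le
      have : 3 * (√3 / 2) * r ≤ 3 * (r * Real.cos w) := by linarith
      gcongr)
  rw [h, setIntegral_congr_fun measurableSet_Ioi fun r _ => sectorKernel_ray r]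
  congr 1
  exact integral_complex_ofReal

theorem sectorKernel_neg_ofReal (x : ℝ) :
    sectorKernel (-x : ℝ) = starRingEnd ℂ (sectorKernel x) := by
  simp only [sectorKernel, map_div₀, map_pow, map_add, ← Complex.exp_conj, map_mul, map_neg,
    Complex.conj_ofReal, Complex.conj_I]
  push_cast
  ring_nf

/-- The two half-lines contribute complex conjugate values, with arguments `± π / 6`. -/
theorem integral_cubicKernel_one :
    ∫ x : ℝ, cubicKernel 1 x =
      ((√3 * ∫ x in Set.Ioi (0 : ℝ),
        Real.exp (x * √3) / (2 * Real.cos x + Real.exp (x * √3)) ^ 3 : ℝ) : ℂ) := by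
  have hint : Integrable fun x : ℝ => sectorKernel x :=
    (integrable_cubicKernel one_pos).congr (ae_of_all _ cubicKernel_one)
  simp only [cubicKernel_one]
  rw [← intervalIntegral.integral_Iic_add_Ioi hint.integrableOn hint.integrableOn (b := 0),
    ← neg_zero, ← integral_comp_neg_Ioi]
  simp only [sectorKernel_neg_ofReal, neg_zero]
  rw [integral_conj, integral_Ioi_sectorKernel, exp_pi_div_six_mul_I]
  simp only [map_mul, map_add, Complex.conj_ofReal, Complex.conj_I]
  push_cast
  ring

theorem mainTheorem6 :
    (∀ b : ℝ, 0 < b →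
      (∀ x : ℝ, 0 ≤ x →
        Multipliable (fun k : ℕ => 1 + x ^ 3 / ((k : ℝ) + b) ^ 3)) ∧
      IntegrableOn
        (fun x : ℝ => 1 / ∏' k : ℕ, (1 + x ^ 3 / ((k : ℝ) + b) ^ 3)) (Set.Ioi 0) ∧
      Integrable
        (fun x : ℝ =>
          Complex.exp (Complex.I * x * b * (√3 : ℝ)) /
            (Complex.exp x + Complex.exp (-x) + Complex.exp (Complex.I * x * (√3 : ℝ))) ^
              (3 * b : ℂ)) ∧
      ((∫ x in Set.Ioi (0 : ℝ), 1 / ∏' k : ℕ, (1 + x ^ 3 / ((k : ℝ) + b) ^ 3) : ℝ) : ℂ) =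
        ((4 * Real.pi * Real.Gamma (3 * b) / (Real.Gamma b ^ 3 * √3) : ℝ) : ℂ) *
          ∫ x : ℝ,
            Complex.exp (Complex.I * x * b * (√3 : ℝ)) /
              (Complex.exp x + Complex.exp (-x) + Complex.exp (Complex.I * x * (√3 : ℝ))) ^
                (3 * b : ℂ)) ∧
    IntegrableOn
      (fun x : ℝ => Real.exp (x * √3) / (2 * Real.cos x + Real.exp (x * √3)) ^ 3)
      (Set.Ioi 0) ∧
    ∫ x in Set.Ioi (0 : ℝ), 1 / ∏' k : ℕ, (1 + x ^ 3 / ((k : ℝ) + 1) ^ 3) =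
      8 * Real.pi *
        ∫ x in Set.Ioi (0 : ℝ),
          Real.exp (x * √3) / (2 * Real.cos x + Real.exp (x * √3)) ^ 3 := by
  refine ⟨fun b hb => ⟨fun x _ => multipliable_one_add_cube_div hb x, integrableOn_inv_tprod hb,
    integrable_cubicKernel hb, integral_inv_tprod_eq hb⟩, integrableOn_exp_div_two_cos, ?_⟩
  have h := integral_inv_tprod_eq one_pos
  have hG : Real.Gamma (3 * 1) = 2 := by
    rw [show (3 * 1 : ℝ) = (2 : ℕ) + 1 by norm_num, Real.Gamma_nat_eq_factorial]
    norm_num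
  rw [integral_cubicKernel_one, hG, Real.Gamma_one] at h
  rw [Complex.ofReal_injective (h.trans (Complex.ofReal_mul _ _).symm)]
  generalize (∫ x in Set.Ioi (0 : ℝ),
    Real.exp (x * √3) / (2 * Real.cos x + Real.exp (x * √3)) ^ 3) = K
  field_simp
  ring
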